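/- Let $q \ge 3$ be a prime power, let $n, m \ge 0$, $N, r \ge 1$ be integers, and let $\varepsilon$ be a real number. *The instance.* Let $\Psi$ be a Max NAND instance with $n$ variables and $m$ constraints, each of the form $x_k = 1 + x_i x_j$ over $\mathbb{F}_2$ (for $m=0$ put $\mathrm{Opt}(\Psi)=0$; otherwise $\mathrm{Opt}(\Psi)$ is the maximum fraction of constraints satisfied by an assignment $x \in \mathbb{F}_2^n$). *The pseudorandom set.* Let $R$ be a multiset of $N$ points of $\mathbb{F}_q^n$ that is $\varepsilon$-pseudorandom for polynomials of degree at most $q-1$: for every $f \in \mathbb{F}_q[X_1,\dots,X_n]$ of total degree at most $q-1$, $\sum_{a\in\mathbb{F}_q} |\Pr_{x\sim R}[f(x)=a] - \Pr_{x\sim\mathbb{F}_q^n}[f(x)=a]| \le \varepsilon$. For $1 \le d \le q-1$ let $P_d \subseteq \mathbb{F}_q^N$ be the space of vectors $(p(x))_{x\in R}$ with $\deg p \le d$ and $p(0)=0$, and let $P_0$ be the space of constant vectors. For codes $C_1, C_2 \subseteq \mathbb{F}_q^N$ let $C_1\otimes C_2$ be the space of $N\times N$ matrices with all columns in $C_1$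 and all rows in $C_2$. For $\alpha \in \mathbb{F}_q^n$ let $C(\alpha) = (\sum_i \alpha_i x_i)_{x\in R}$. *The code.* Consider variables $\alpha\in\mathbb{F}_q^n$, $Y_0 \in \mathbb{F}_q$, $Y^e\in\mathbb{F}_q^N$ ($0\le e\le 2(q-1)$), $Y^{e,f}\in\mathbb{F}_q^{N\times N}$ ($0\le e,f\le q-1$), $Z_{st}:\mathbb{F}_q^2\to\mathbb{F}_q$ ($1 \le s,t\le N$), and, for every constraint $x_k=1+x_ix_j$ of $\Psi$, $S_{ijk}:\mathbb{F}_2^2\to\mathbb{F}_q$, subject to the following linear constraints. 1. $Y^e\in P_e$ for $0\le e\le q-1$; $Y^e=Y^{e-(q-1)}$ for $q\le e\le 2(q-1)$; $Y^1=C(\alpha)$. 2. For $0 \le e,f\le q-1$: $Y^{e,f}\in P_e\otimes P_f$, and the diagonal of $Y^{e,f}$ is $Y^{e+f}$. 3. For $0\le e\le q-1$, all rows of $Y^{0,e}$ are equal and all columns of $Y^{e,0}$ are equal; all entries of $Y^{0,0}$ equal $Y_0$; $Y^{q-1,q-1}$ is symmetric. 4. For every constraint $x_k=1+x_ix_j$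 of $\Psi$: $Y_0=\sum_{a,b} S_{ijk}(a,b)$, $\alpha_i=\sum_{a,b} a\,S_{ijk}(a,b)$, $\alpha_j=\sum_{a,b} b\,S_{ijk}(a,b)$, $\alpha_k=\sum_{a,b}(1\oplus ab)\,S_{ijk}(a,b)$, where $a,b$ range over $\mathbb{F}_2=\{0,1\}$, $\oplus$ is addition in $\mathbb{F}_2$, and otherwise $0,1$ are read in $\mathbb{F}_q$. 5. For all $s,t$ and $0\le e,f\le q-1$: $Y^{e,f}(s,t)=\sum_{x,y\in\mathbb{F}_q}x^ey^fZ_{st}(x,y)$ (with $0^0=1$). Let $\mathcal{C}(\Psi)\subseteq\mathbb{F}_q^{(qN)^2+4rm}$ be the projection of the solution space to the $Z_{st}$ and the $S_{ijk}$, with each $S_{ijk}$ repeated $r$ times, and let $d(\mathcal{C}(\Psi))$ be the minimum Hamming weight of a nonzero codeword. **Lemma (Soundness).** If $\mathrm{Opt}(\Psi)\le 1-\delta$, where $\delta$ is a real number, then $$d(\mathcal{C}(\Psi)) \ \ge\ \min\Bigl(N^2+(1+\delta)rm,\ \bigl(1+\tfrac1q-2q^2\varepsilon\bigr)N^2\Bigr).$$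 In particular, if the effect of $\varepsilon$ is ignored ($\varepsilon=0$), then $d(\mathcal{C}(\Psi))\ge\min\bigl(N^2+(1+\delta)rm,\ (1+1/q)N^2\bigr)$. -/

import Mathlib

namespace MinDistReduction

/-- The distance of a linear code: the minimum Hamming weight of a nonzero codeword. -/
noncomputable def codeDist {F : Type*} [Field F] [DecidableEq F] {ι : Type*} [Fintype ι]
    (C : Submodule F (ι → F)) : ℕ :=
  sInf {k : ℕ | ∃ w ∈ C, w ≠ 0 ∧ hammingNorm w = k}

/-- The tensor product of two linear codes: the matrices all of whose columns lie in `C₁` and all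
of whose rows lie in `C₂`. -/
def tensorCode {F : Type*} [Field F] {N : ℕ} (C₁ C₂ : Submodule F (Fin N → F)) :
    Submodule F (Matrix (Fin N) (Fin N) F) where
  carrier := {A | (∀ j, (fun i => A i j) ∈ C₁) ∧ (∀ i, (fun j => A i j) ∈ C₂)}
  add_mem' := fun ha hb =>
    ⟨fun j => C₁.add_mem (ha.1 j) (hb.1 j), fun i => C₂.add_mem (ha.2 i) (hb.2 i)⟩
  zero_mem' := ⟨fun _ => C₁.zero_mem, fun _ => C₂.zero_mem⟩
  smul_mem' := fun c _ ha =>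
    ⟨fun j => C₁.smul_mem c (ha.1 j), fun i => C₂.smul_mem c (ha.2 i)⟩

/-- An instance of Max NAND with `n` variables and `m` constraints; the constraint with index `c`
is the equation `x_k = 1 + x_i * x_j` over `𝔽₂`, where `i = Ψ.i c`, `j = Ψ.j c`, `k = Ψ.k c`. -/
structure NANDInstance (n m : ℕ) where
  i : Fin m → Fin n
  j : Fin m → Fin n
  k : Fin m → Fin n

/-- The number of constraints satisfied by an assignment. -/
def NANDInstance.numSat {n m : ℕ} (Ψ : NANDInstance n m) (x : Fin n → ZMod 2) : ℕ :=
  (Finset.univ.filter fun c : Fin m => x (Ψ.k c) = 1 + x (Ψ.i c) * x (Ψ.j c)).card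

/-- The maximum fraction of satisfied constraints over all assignments. -/
noncomputable def NANDInstance.opt {n m : ℕ} (Ψ : NANDInstance n m) : ℝ :=
  ⨆ x : Fin n → ZMod 2, (Ψ.numSat x : ℝ) / (m : ℝ)

/-- The multiset `R = {R 0, …, R (N-1)}` of points of `𝔽_q^n` is `ε`-pseudorandom for polynomials
of total degree at most `d`: for each such polynomial `f`, the distribution of `f` at a uniformly
random element of `R` and the distribution of `f` at a uniformly random point of `𝔽_q^n` are at
`ℓ¹`-distance at most `ε`. -/
def IsPseudorandom {F : Type*} [Field F] [Fintype F] [DecidableEq F] {n N : ℕ}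
    (R : Fin N → Fin n → F) (d : ℕ) (ε : ℝ) : Prop :=
  ∀ f : MvPolynomial (Fin n) F, f.totalDegree ≤ d →
    ∑ a : F,
      |((Finset.univ.filter fun t : Fin N => MvPolynomial.eval (R t) f = a).card : ℝ) / (N : ℝ) -
        ((Finset.univ.filter fun x : Fin n → F => MvPolynomial.eval x f = a).card : ℝ) /
          (Fintype.card F : ℝ) ^ n| ≤ ε

/-- The code `P_d`. For `d ≥ 1` it consists of the evaluation vectors on `R` of the polynomials of
total degree at most `d` without constant term; `P_0` consists of the constant vectors, that is, of
the evaluation vectors of the polynomials of degree `0`. -/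
def polyCode {F : Type*} [Field F] {n N : ℕ} (R : Fin N → Fin n → F) (d : ℕ) :
    Submodule F (Fin N → F) where
  carrier := {v | ∃ p : MvPolynomial (Fin n) F, p.totalDegree ≤ d ∧
    (1 ≤ d → MvPolynomial.eval 0 p = 0) ∧ ∀ t, v t = MvPolynomial.eval (R t) p}
  add_mem' := by
    rintro v w ⟨p, hp, hp0, hpv⟩ ⟨p', hp', hp0', hpv'⟩
    refine ⟨p + p', (MvPolynomial.totalDegree_add _ _).trans (max_le hp hp'), fun hd => ?_,
      fun t => ?_⟩
    · rw [map_add, hp0 hd, hp0' hd, add_zero]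
    · rw [Pi.add_apply, map_add, hpv, hpv']
  zero_mem' := ⟨0, by simp, by simp, by simp⟩
  smul_mem' := by
    rintro c v ⟨p, hp, hp0, hpv⟩
    refine ⟨c • p, (MvPolynomial.totalDegree_smul_le _ _).trans hp, fun hd => ?_, fun t => ?_⟩
    · rw [MvPolynomial.smul_eval, hp0 hd, mul_zero]
    · rw [Pi.smul_apply, MvPolynomial.smul_eval, hpv, smul_eq_mul]

/-- The variables of the code `C'(Ψ)`:
* `α i`, the coordinates of the vector `α = C⁻¹(Y¹)` encoded by `Y¹`;
* `Y0`, the common value of the entries of `Y^{0,0}`;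
* `vec e s`, the entry `Y^e(s)` of the vector `Y^e` (`0 ≤ e ≤ 2(q-1)`);
* `mat e f s t`, the entry `Y^{e,f}(s,t)` of the matrix `Y^{e,f}` (`0 ≤ e, f ≤ q-1`);
* `Z s t x y`, the value `Z_{st}(x,y)`;
* `S c a b`, the value at `(a,b)` of the function `S_{ijk}` of the constraint with index `c`.

Only `vec e` with `e ≤ 2(q-1)` and `mat e f` with `e, f ≤ q-1` take part in the constraints. -/
inductive Var (F : Type*) (n m N : ℕ)
  | α (i : Fin n)
  | Y0
  | vec (e : ℕ) (s : Fin N)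
  | mat (e f : ℕ) (s t : Fin N)
  | Z (s t : Fin N) (x y : F)
  | S (c : Fin m) (a b : ZMod 2)

/-- The basic constraints, with `q = |F|`. -/
structure BasicConstraints {F : Type*} [Field F] [Fintype F] {n m N : ℕ}
    (R : Fin N → Fin n → F) (v : Var F n m N → F) : Prop where
  vec_mem : ∀ e ≤ Fintype.card F - 1, (fun s => v (.vec e s)) ∈ polyCode R e
  vec_high : ∀ e, Fintype.card F ≤ e → e ≤ 2 * (Fintype.card F - 1) →
    ∀ s, v (.vec e s) = v (.vec (e - (Fintype.card F - 1)) s)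
  mat_mem : ∀ e ≤ Fintype.card F - 1, ∀ f ≤ Fintype.card F - 1,
    Matrix.of (fun s t => v (.mat e f s t)) ∈ tensorCode (polyCode R e) (polyCode R f)
  mat_diag : ∀ e ≤ Fintype.card F - 1, ∀ f ≤ Fintype.card F - 1,
    ∀ s, v (.mat e f s s) = v (.vec (e + f) s)
  rows_eq : ∀ e ≤ Fintype.card F - 1, ∀ s s' t, v (.mat 0 e s t) = v (.mat 0 e s' t)
  cols_eq : ∀ e ≤ Fintype.card F - 1, ∀ s t t', v (.mat e 0 s t) = v (.mat e 0 s t')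
  symm : ∀ s t, v (.mat (Fintype.card F - 1) (Fintype.card F - 1) s t) =
    v (.mat (Fintype.card F - 1) (Fintype.card F - 1) t s)
  Y0_eq : ∀ s t, v (.mat 0 0 s t) = v .Y0
  α_eq : ∀ s, v (.vec 1 s) = ∑ i, v (.α i) * R s i

/-- The consistency constraints. An element `a` of `𝔽₂ = {0, 1}` is viewed as the element `0` or
`1` of `F`. -/
structure ConsistencyConstraints {F : Type*} [Field F] [Fintype F] {n m N : ℕ}
    (Ψ : NANDInstance n m) (v : Var F n m N → F) : Prop where
  S_sum : ∀ c, v .Y0 = ∑ a : ZMod 2, ∑ b : ZMod 2, v (.S c a b)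
  S_i : ∀ c, v (.α (Ψ.i c)) = ∑ a : ZMod 2, ∑ b : ZMod 2, (a.val : F) * v (.S c a b)
  S_j : ∀ c, v (.α (Ψ.j c)) = ∑ a : ZMod 2, ∑ b : ZMod 2, (b.val : F) * v (.S c a b)
  S_k : ∀ c, v (.α (Ψ.k c)) =
    ∑ a : ZMod 2, ∑ b : ZMod 2, ((1 + a * b : ZMod 2).val : F) * v (.S c a b)
  Z_eq : ∀ e ≤ Fintype.card F - 1, ∀ f ≤ Fintype.card F - 1, ∀ s t,
    v (.mat e f s t) = ∑ x : F, ∑ y : F, x ^ e * y ^ f * v (.Z s t x y)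

/-- The code `C'(Ψ)`. -/
def fullCode {F : Type*} [Field F] [Fintype F] {n m N : ℕ}
    (R : Fin N → Fin n → F) (Ψ : NANDInstance n m) : Submodule F (Var F n m N → F) where
  carrier := {v | BasicConstraints R v ∧ ConsistencyConstraints Ψ v}
  add_mem' := by
    rintro v w ⟨hv, hv'⟩ ⟨hw, hw'⟩
    refine ⟨⟨?_, ?_, ?_, ?_, ?_, ?_, ?_, ?_, ?_⟩, ⟨?_, ?_, ?_, ?_, ?_⟩⟩
    · exact fun e he => (polyCode R e).add_mem (hv.vec_mem e he) (hw.vec_mem e he)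
    · intro e h1 h2 s
      rw [Pi.add_apply, Pi.add_apply, hv.vec_high e h1 h2, hw.vec_high e h1 h2]
    · exact fun e he f hf =>
        (tensorCode _ _).add_mem (hv.mat_mem e he f hf) (hw.mat_mem e he f hf)
    · intro e he f hf s
      rw [Pi.add_apply, Pi.add_apply, hv.mat_diag e he f hf, hw.mat_diag e he f hf]
    · intro e he s s' t
      rw [Pi.add_apply, Pi.add_apply, hv.rows_eq e he s s', hw.rows_eq e he s s']
    · intro e he s t t'
      rw [Pi.add_apply, Pi.add_apply, hv.cols_eq e he s t t', hw.cols_eq e he s t t']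
    · intro s t
      rw [Pi.add_apply, Pi.add_apply, hv.symm s t, hw.symm s t]
    · intro s t
      rw [Pi.add_apply, Pi.add_apply, hv.Y0_eq s t, hw.Y0_eq s t]
    · intro s
      rw [Pi.add_apply, hv.α_eq s, hw.α_eq s, ← Finset.sum_add_distrib]
      simp only [Pi.add_apply, add_mul]
    · intro c
      simp only [Pi.add_apply, Finset.sum_add_distrib, hv'.S_sum c, hw'.S_sum c]
    · intro c
      simp only [Pi.add_apply, mul_add, Finset.sum_add_distrib, hv'.S_i c, hw'.S_i c]
    · intro c
      simp only [Pi.add_apply, mul_add, Finset.sum_add_distrib, hv'.S_j c, hw'.S_j c]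
    · intro c
      simp only [Pi.add_apply, mul_add, Finset.sum_add_distrib, hv'.S_k c, hw'.S_k c]
    · intro e he f hf s t
      simp only [Pi.add_apply, mul_add, Finset.sum_add_distrib, hv'.Z_eq e he f hf s t,
        hw'.Z_eq e he f hf s t]
  zero_mem' := by
    refine ⟨⟨?_, ?_, ?_, ?_, ?_, ?_, ?_, ?_, ?_⟩, ⟨?_, ?_, ?_, ?_, ?_⟩⟩
    · exact fun e _ => (polyCode R e).zero_mem
    · intros; rfl
    · exact fun e _ f _ => (tensorCode (polyCode R e) (polyCode R f)).zero_mem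
    all_goals simp
  smul_mem' := by
    rintro r v ⟨hv, hv'⟩
    refine ⟨⟨?_, ?_, ?_, ?_, ?_, ?_, ?_, ?_, ?_⟩, ⟨?_, ?_, ?_, ?_, ?_⟩⟩
    · exact fun e he => (polyCode R e).smul_mem r (hv.vec_mem e he)
    · intro e h1 h2 s
      rw [Pi.smul_apply, Pi.smul_apply, hv.vec_high e h1 h2]
    · exact fun e he f hf => (tensorCode _ _).smul_mem r (hv.mat_mem e he f hf)
    · intro e he f hf s
      rw [Pi.smul_apply, Pi.smul_apply, hv.mat_diag e he f hf]
    · intro e he s s' t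
      rw [Pi.smul_apply, Pi.smul_apply, hv.rows_eq e he s s']
    · intro e he s t t'
      rw [Pi.smul_apply, Pi.smul_apply, hv.cols_eq e he s t t']
    · intro s t
      rw [Pi.smul_apply, Pi.smul_apply, hv.symm s t]
    · intro s t
      rw [Pi.smul_apply, Pi.smul_apply, hv.Y0_eq s t]
    · intro s
      simp only [Pi.smul_apply, smul_eq_mul, hv.α_eq s, Finset.mul_sum, mul_assoc]
    · intro c
      simp only [Pi.smul_apply, smul_eq_mul, hv'.S_sum c, Finset.mul_sum]
    · intro c
      simp only [Pi.smul_apply, smul_eq_mul, hv'.S_i c, Finset.mul_sum, mul_left_comm r]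
    · intro c
      simp only [Pi.smul_apply, smul_eq_mul, hv'.S_j c, Finset.mul_sum, mul_left_comm r]
    · intro c
      simp only [Pi.smul_apply, smul_eq_mul, hv'.S_k c, Finset.mul_sum, mul_left_comm r]
    · intro e he f hf s t
      simp only [Pi.smul_apply, smul_eq_mul, hv'.Z_eq e he f hf s t, Finset.mul_sum,
        mul_left_comm r]

/-- The `(qN)² + 4rm` coordinates of the final code: one for each value `Z_{st}(x,y)` and `r`
copies of each value `S_{ijk}(a,b)`. -/
abbrev Coord (F : Type*) (m N r : ℕ) : Type _ :=
  (Fin N × Fin N × F × F) ⊕ (Fin r × Fin m × ZMod 2 × ZMod 2)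

/-- The variable of `C'(Ψ)` that stands at a coordinate of the final code. -/
def Coord.toVar {F : Type*} {n m N r : ℕ} : Coord F m N r → Var F n m N
  | .inl (s, t, x, y) => .Z s t x y
  | .inr (_, c, a, b) => .S c a b

/-- The final code `C(Ψ)`: the projection of `C'(Ψ)` to the `Z` variables and to the `S` variables,
with each of the latter repeated `r` times. -/
def code {F : Type*} [Field F] [Fintype F] {n m N : ℕ}
    (R : Fin N → Fin n → F) (Ψ : NANDInstance n m) (r : ℕ) : Submodule F (Coord F m N r → F) :=
  (fullCode R Ψ).map (LinearMap.funLeft F F (Coord.toVar (n := n)))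

end MinDistReduction

/-!
Consider a nonzero codeword. Its weight is the sum of the weights of the functions `Z s t`, plus `r`
times the sum of the weights of the functions `S c`.

If `Y0 ≠ 0`, then no `Z s t` and no `S c` vanishes, since the values of each sum to `Y0`. Moreover,
an `S c` of weight `1` forces the constraint `c` to hold for the assignment read off from `α / Y0`
(`ConsistencyConstraints.sat_of_weight₂_le_one`), so that at least `δ m` of the `S c` have weight at
least `2`. This gives the first term of the minimum (`le_weight_of_Y0_ne_zero`).

If `Y0 = 0`, then some matrix `Y^{e,f}` is nonzero (`exists_mat_ne_zero`): if all of them vanish,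
so do the functions `Z s t`, as they are determined by their moments, and `α`, as `R` is
pseudorandom, and then the `S c`. Take `(e, f)` lexicographically smallest with `Y^{e,f} ≠ 0`. Two
estimates are multiplied.
* Where `Y^{e,f}` is nonzero, `Z s t` has weight at least `(e + 1) (f + 1)`
  (`mul_le_weight₂_of_moment_ne_zero`).
* By the Schwartz–Zippel lemma and pseudorandomness, the fraction of nonzero entries of `Y^{e,f}` is
  at least `(1 - e / q - ε) (1 - f / q - ε)` (`le_hammingNorm_of_mem_polyCode`,
  `mul_le_weight₂_of_mem_tensorCode`).

Now `(x + 1) (1 - x / q)` is `1` at `x = 0` and at `x = q - 1`, and is at least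
`2 (1 - 1 / q) ≥ 1 + 1 / q` at the integers between, so that the product suffices
(`le_footprint_mul_distance`) unless both `e` and `f` lie in `{0, q - 1}`. Of these four cases
`(0, 0)` is excluded by `Y0 = 0`, and `(q - 1, 0)` because `Y^{0,q-1}` and `Y^{q-1,0}` both encode
the vector `Y^{q-1}`. In the case `(0, q - 1)` both of these matrices are nonzero, and the union of
their supports has density about `2 / q - 1 / q²` (`le_weight_of_vec_ne_zero`). In the case
`(q - 1, q - 1)` the matrix is symmetric with zero diagonal, so that its rows contain a
two-dimensional code, and the second generalized Hamming weight improves the number of nonzero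
columns by the factor `1 + 1 / q` (`card_support_pair`, `le_weight_of_mat_top_ne_zero`).

The distance is defined as an infimum of natural numbers, which is `0` for the zero code, so it also
has to be shown that the code is nonzero (`exists_mem_code_ne_zero`). For `ε ≥ 1 / q` the second
term of the minimum is not positive, and nothing is to be shown; for smaller `ε` pseudorandomness
provides two points of `R` whose first coordinates are distinct and nonzero, from which a codeword
is built.
-/

namespace MinDistReduction

variable {F : Type*} [Field F] [Fintype F]

section

/-! ### The footprint bound -/

/-- The mixed power moment `∑ x^e y^f z(x,y)` of a function `z` on `F²`, with `0 ^ 0 = 1`. -/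
def moment (z : F → F → F) (e f : ℕ) : F := ∑ x : F, ∑ y : F, x ^ e * y ^ f * z x y

/-- The Hamming weight of a function of two variables, that is, the number of nonzero values. -/
def weight₂ {α β M : Type*} [Fintype α] [Fintype β] [Zero M] [DecidableEq M]
    (z : α → β → M) : ℕ :=
  hammingNorm fun p : α × β => z p.1 p.2

theorem exists_pow_eq_pow_of_lt_card (k : ℕ) :
    ∃ k' < Fintype.card F, ∀ y : F, y ^ k = y ^ k' := by
  induction k using Nat.strong_induction_on with
  | _ k ih =>
    by_cases hk : k < Fintype.card F
    · exact ⟨k, hk, fun _ => rfl⟩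
    · have hq : 1 < Fintype.card F := Fintype.one_lt_card
      obtain ⟨k', hk', h⟩ := ih (k - Fintype.card F + 1) (by omega)
      refine ⟨k', hk', fun y => ?_⟩
      calc y ^ k = y ^ (k - Fintype.card F) * y ^ Fintype.card F := by
            rw [← pow_add, Nat.sub_add_cancel (by omega)]
        _ = y ^ k' := by rw [FiniteField.pow_card, ← pow_succ, h]

theorem moment_swap (z : F → F → F) (e f : ℕ) :
    moment (fun x y => z y x) e f = moment z f e := by
  unfold moment
  rw [Finset.sum_comm]
  simp only [mul_comm]

theorem weight₂_swap {α β M : Type*} [Fintype α] [Fintype β] [Zero M] [DecidableEq M]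
    (z : α → β → M) : weight₂ (fun x y => z y x) = weight₂ z := by
  unfold weight₂ hammingNorm
  refine Finset.card_equiv (Equiv.prodComm β α) ?_
  simp

variable [DecidableEq F]

/-- The footprint bound: if `(e, f)` is the lexicographically smallest exponent at which `z` has a
nonzero moment, then `z` has at least `(e + 1) (f + 1)` nonzero values. Otherwise some nonzero
combination of the monomials `x^a y^b` with `a ≤ e` and `b ≤ f` vanishes on the support of `z`;
multiplying it by a monomial moves its leading exponent to `(e, f)`, and the sum of the product
against `z` is zero on the one hand and a nonzero multiple of the moment at `(e, f)` on the other. -/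
theorem mul_le_weight₂_of_moment_ne_zero {z : F → F → F} {e f : ℕ}
    (h₁ : ∀ e' < e, ∀ f' < Fintype.card F, moment z e' f' = 0)
    (h₂ : ∀ f' < f, moment z e f' = 0) (h : moment z e f ≠ 0) :
    (e + 1) * (f + 1) ≤ weight₂ z := by
  by_contra! hlt
  have h₁' : ∀ e' < e, ∀ k, moment z e' k = 0 := by
    intro e' he' k
    obtain ⟨k', hk', hpow⟩ := exists_pow_eq_pow_of_lt_card (F := F) k
    rw [← h₁ e' he' k' hk']
    simp only [moment, hpow]
  let M : Matrix {p : F × F // z p.1 p.2 ≠ 0} (Fin (e + 1) × Fin (f + 1)) F :=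
    Matrix.of fun p ab => p.1.1 ^ (ab.1 : ℕ) * p.1.2 ^ (ab.2 : ℕ)
  have hker : LinearMap.ker M.mulVecLin ≠ ⊥ := by
    apply LinearMap.ker_ne_bot_of_finrank_lt
    rw [Module.finrank_fintype_fun_eq_card, Module.finrank_fintype_fun_eq_card,
      Fintype.card_prod, Fintype.card_fin, Fintype.card_fin, Fintype.card_subtype]
    exact hlt
  obtain ⟨c, hc, hc0⟩ := (Submodule.ne_bot_iff _).1 hker
  have hvan : ∀ x y, z x y ≠ 0 → ∑ ab, x ^ (ab.1 : ℕ) * y ^ (ab.2 : ℕ) * c ab = 0 := by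
    intro x y hxy
    exact congrFun (LinearMap.mem_ker.1 hc) ⟨(x, y), hxy⟩
  obtain ⟨ab₀, hab₀⟩ := Function.ne_iff.1 hc0
  obtain ⟨ab, hab, hmax⟩ := Finset.exists_max_image
    (Finset.univ.filter fun ab : Fin (e + 1) × Fin (f + 1) => c ab ≠ 0)
    (fun ab => toLex ab) ⟨ab₀, by simpa using hab₀⟩
  have hab0 : c ab ≠ 0 := by simpa using hab
  have hsum : ∑ ab' : Fin (e + 1) × Fin (f + 1),
      c ab' * moment z (e - ab.1 + ab'.1) (f - ab.2 + ab'.2) = 0 := by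
    calc
      _ = ∑ x : F, ∑ y : F, x ^ (e - (ab.1 : ℕ)) * y ^ (f - (ab.2 : ℕ)) *
          (∑ ab' : Fin (e + 1) × Fin (f + 1), x ^ (ab'.1 : ℕ) * y ^ (ab'.2 : ℕ) * c ab') *
            z x y := by
        simp only [moment, Finset.mul_sum, Finset.sum_mul]
        rw [Finset.sum_comm]
        refine Finset.sum_congr rfl fun x _ => ?_
        rw [Finset.sum_comm]
        refine Finset.sum_congr rfl fun y _ => Finset.sum_congr rfl fun ab' _ => ?_
        rw [pow_add, pow_add]
        ring
      _ = 0 := by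
        refine Finset.sum_eq_zero fun x _ => Finset.sum_eq_zero fun y _ => ?_
        by_cases hxy : z x y = 0
        · rw [hxy, mul_zero]
        · rw [hvan x y hxy, mul_zero, zero_mul]
  rw [Finset.sum_eq_single ab] at hsum
  · rw [Nat.sub_add_cancel (by omega), Nat.sub_add_cancel (by omega)] at hsum
    exact (mul_ne_zero hab0 h) hsum
  · intro ab' _ hne
    by_cases hc' : c ab' = 0
    · rw [hc', zero_mul]
    have hle := hmax ab' (by simpa using hc')
    have hlt' : toLex ab' < toLex ab :=
      lt_of_le_of_ne hle fun h => hne (toLex.injective h)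
    rw [Prod.Lex.toLex_lt_toLex] at hlt'
    rcases hlt' with h' | ⟨h', h''⟩
    · rw [h₁' _ (by omega), mul_zero]
    · rw [h', Nat.sub_add_cancel (by omega), h₂ _ (by omega), mul_zero]
  · simp

/-! ### Weights in codes -/

/-- A nonzero polynomial of degree at most `d ≤ q - 1` is nonzero at a fraction of at least
`1 - d / q - ε` of the points of `R`, by the Schwartz–Zippel lemma and pseudorandomness. -/
theorem IsPseudorandom.le_card_eval_ne_zero {n N : ℕ} (hN : 0 < N) {ε : ℝ} {R : Fin N → Fin n → F}
    (hR : IsPseudorandom R (Fintype.card F - 1) ε) {d : ℕ} (hd : d ≤ Fintype.card F - 1)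
    {p : MvPolynomial (Fin n) F} (hp : p.totalDegree ≤ d) (hp0 : p ≠ 0) :
    (1 - d / Fintype.card F - ε) * N ≤
      ((Finset.univ.filter fun t : Fin N => MvPolynomial.eval (R t) p ≠ 0).card : ℝ) := by
  have hSZ : ((Finset.univ.filter fun x : Fin n → F => MvPolynomial.eval x p = 0).card : ℝ) /
      (Fintype.card F : ℝ) ^ n ≤ d / Fintype.card F := by
    have h := MvPolynomial.schwartz_zippel_totalDegree hp0 (Finset.univ : Finset F)
    rw [Fintype.piFinset_univ, Finset.card_univ] at h
    have h' := (NNRat.cast_le (K := ℝ)).2 h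
    push_cast at h'
    exact h'.trans (by gcongr)
  have hpr := (Finset.single_le_sum (fun a _ => abs_nonneg _) (Finset.mem_univ (0 : F))).trans
    (hR p (hp.trans hd))
  have hpr' := (abs_le.1 hpr).2
  have hcount : ((Finset.univ.filter fun t : Fin N => MvPolynomial.eval (R t) p = 0).card : ℝ) +
      ((Finset.univ.filter fun t : Fin N => MvPolynomial.eval (R t) p ≠ 0).card : ℝ) = N := by
    have h := Finset.card_filter_add_card_filter_not (s := (Finset.univ : Finset (Fin N)))
      (fun t => MvPolynomial.eval (R t) p = 0)
    rw [Finset.card_univ, Fintype.card_fin] at h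
    exact_mod_cast h
  have hN' : (0 : ℝ) < N := by exact_mod_cast hN
  have : ((Finset.univ.filter fun t : Fin N => MvPolynomial.eval (R t) p = 0).card : ℝ) / N ≤
      d / Fintype.card F + ε := by linarith
  rw [div_le_iff₀ hN'] at this
  linarith

/-- The relative distance of `P_d` is at least `1 - d / q - ε`. -/
theorem le_hammingNorm_of_mem_polyCode {n N : ℕ} (hN : 0 < N) {ε : ℝ} {R : Fin N → Fin n → F}
    (hR : IsPseudorandom R (Fintype.card F - 1) ε) {d : ℕ} (hd : d ≤ Fintype.card F - 1)
    {v : Fin N → F} (hv : v ∈ polyCode R d) (hv0 : v ≠ 0) :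
    (1 - d / Fintype.card F - ε) * N ≤ (hammingNorm v : ℝ) := by
  obtain ⟨p, hp, -, hpv⟩ := hv
  have hp0 : p ≠ 0 := by
    rintro rfl
    exact hv0 (funext fun t => by simp [hpv])
  simpa only [hammingNorm, hpv] using hR.le_card_eval_ne_zero hN hd hp hp0

theorem weight₂_eq_sum {α β M : Type*} [Fintype α] [Fintype β] [Zero M] [DecidableEq M]
    (A : α → β → M) : weight₂ A = ∑ i, hammingNorm (A i) := by
  unfold weight₂ hammingNorm
  simp only [Finset.card_filter]
  exact Fintype.sum_prod_type _

/-- If each nonzero column of a matrix has weight at least `a`, then its weight is at least `a`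
times the number of nonzero columns. -/
theorem card_mul_le_weight₂ {α β M : Type*} [Fintype α] [Fintype β] [Zero M] [DecidableEq M]
    {A : α → β → M} {a : ℝ} (T : Finset β) (hT : ∀ j ∈ T, a ≤ hammingNorm fun i => A i j) :
    T.card * a ≤ (weight₂ A : ℝ) := by
  rw [← weight₂_swap A, weight₂_eq_sum]
  push_cast
  calc (T.card : ℝ) * a = ∑ _j ∈ T, a := by rw [Finset.sum_const, nsmul_eq_mul]
    _ ≤ ∑ j ∈ T, (hammingNorm fun i => A i j : ℝ) := Finset.sum_le_sum hT
    _ ≤ _ := Finset.sum_le_sum_of_subset_of_nonneg (Finset.subset_univ T)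
      fun _ _ _ => Nat.cast_nonneg _

omit [Fintype F] in
/-- The distance of a tensor product is at least the product of the distances. -/
theorem mul_le_weight₂_of_mem_tensorCode {N : ℕ} {C₁ C₂ : Submodule F (Fin N → F)} {a b : ℝ}
    (ha : 0 ≤ a)
    (h₁ : ∀ v ∈ C₁, v ≠ 0 → a ≤ hammingNorm v) (h₂ : ∀ v ∈ C₂, v ≠ 0 → b ≤ hammingNorm v)
    {A : Matrix (Fin N) (Fin N) F} (hA : A ∈ tensorCode C₁ C₂) (hA0 : A ≠ 0) :
    a * b ≤ (weight₂ A : ℝ) := by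
  obtain ⟨i, hi⟩ := Function.ne_iff.1 hA0
  have hrow := h₂ _ (hA.2 i) hi
  refine le_trans ?_ (card_mul_le_weight₂ (a := a)
    (Finset.univ.filter fun j => A i j ≠ 0) fun j hj => ?_)
  · rw [mul_comm]
    exact mul_le_mul_of_nonneg_right hrow ha
  · refine h₁ _ (hA.1 j) (Function.ne_iff.2 ⟨i, ?_⟩)
    simpa using hj

/-- The second generalized Hamming weight: if the `q + 1` points `v` and `u + c v` of the
projective line spanned by `u` and `v` all have weight at least `d`, then `u` and `v` together have
support of size at least `(1 + 1 / q) d`, since each position of the support vanishes at exactly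
one of these points. -/
theorem card_support_pair {ι : Type*} [Fintype ι] {u v : ι → F} {d : ℝ}
    (hv : d ≤ hammingNorm v) (huv : ∀ c : F, d ≤ hammingNorm (u + c • v)) :
    (Fintype.card F + 1) * d ≤
      Fintype.card F * ((Finset.univ.filter fun t => u t ≠ 0 ∨ v t ≠ 0).card : ℝ) := by
  have key : hammingNorm v + ∑ c : F, hammingNorm (u + c • v) ≤
      Fintype.card F * (Finset.univ.filter fun t => u t ≠ 0 ∨ v t ≠ 0).card := by
    simp only [hammingNorm, Finset.card_filter]
    rw [Finset.sum_comm, ← Finset.sum_add_distrib, Finset.mul_sum]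
    refine Finset.sum_le_sum fun t _ => ?_
    rw [← Finset.card_filter]
    by_cases hvt : v t = 0
    · by_cases hut : u t = 0
      · simp [hvt, hut]
      · simp [hvt, hut]
    · have hcard : (Finset.univ.filter fun c : F => (u + c • v) t ≠ 0).card + 1 ≤
          Fintype.card F := by
        refine Finset.card_lt_univ_of_notMem (x := - u t / v t) ?_
        simp [hvt]
      simp only [hvt, ne_eq, not_false_eq_true, if_true, or_true, mul_one]
      rw [add_comm]
      exact hcard
  have key' : (hammingNorm v : ℝ) + ∑ c : F, (hammingNorm (u + c • v) : ℝ) ≤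
      Fintype.card F * ((Finset.univ.filter fun t => u t ≠ 0 ∨ v t ≠ 0).card : ℝ) := by
    exact_mod_cast key
  refine le_trans ?_ key'
  have : (Fintype.card F : ℝ) * d ≤ ∑ c : F, (hammingNorm (u + c • v) : ℝ) := by
    rw [← nsmul_eq_mul, ← Finset.card_univ, ← Finset.sum_const]
    exact Finset.sum_le_sum fun c _ => huv c
  linarith

end

section

/-! ### Weights of codewords of the final code -/

theorem sum_zmod_two {M : Type*} [AddCommMonoid M] (g : ZMod 2 → M) :
    ∑ a : ZMod 2, g a = g 0 + g 1 :=
  Fin.sum_univ_two g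

/-- Invertibility of the Vandermonde matrix of all elements of `F`. -/
theorem eq_zero_of_moments_eq_zero₁ {u : F → F}
    (h : ∀ k < Fintype.card F, ∑ x : F, x ^ k * u x = 0) : u = 0 := by
  let σ := Fintype.equivFin F
  have h0 : (fun j => u (σ.symm j)) = 0 := by
    refine Matrix.eq_zero_of_forall_pow_sum_mul_pow_eq_zero (f := σ.symm) σ.symm.injective ?_
    intro k
    rw [← h k k.2, ← σ.symm.sum_comp]
    exact Finset.sum_congr rfl fun _ _ => mul_comm _ _
  funext x
  simpa using congrFun h0 (σ x)

/-- A function on `F²` is determined by its moments with exponents at most `q - 1`. -/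
theorem eq_zero_of_moments_eq_zero {z : F → F → F}
    (h : ∀ e < Fintype.card F, ∀ f < Fintype.card F, moment z e f = 0) : z = 0 := by
  have h' : ∀ f < Fintype.card F, (fun x => ∑ y : F, y ^ f * z x y) = 0 := by
    intro f hf
    refine eq_zero_of_moments_eq_zero₁ fun e he => ?_
    rw [← h e he f hf]
    simp only [moment, Finset.mul_sum, mul_assoc]
  funext x
  exact eq_zero_of_moments_eq_zero₁ fun f hf => congrFun (h' f hf) x

variable [DecidableEq F]

theorem hammingNorm_toVar {n m N r : ℕ} (v : Var F n m N → F) :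
    hammingNorm (fun c : Coord F m N r => v c.toVar) =
      ∑ s, ∑ t, weight₂ (fun x y => v (.Z s t x y)) +
        r * ∑ c, weight₂ (fun a b => v (.S c a b)) := by
  simp only [weight₂, hammingNorm, Finset.card_filter]
  rw [Fintype.sum_sum_type, Fintype.sum_prod_type, Fintype.sum_prod_type]
  simp only [Fintype.sum_prod_type]
  refine congrArg₂ _ rfl (Eq.trans (b := ∑ _x : Fin r, ∑ c : Fin m, ∑ a : ZMod 2, ∑ b : ZMod 2,
    if v (.S c a b) ≠ 0 then 1 else 0) rfl ?_)
  rw [Finset.sum_const, Finset.card_univ, Fintype.card_fin, smul_eq_mul]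

theorem one_le_weight₂ {α β M : Type*} [Fintype α] [Fintype β] [Zero M] [DecidableEq M]
    {z : α → β → M}
    (hz : z ≠ 0) : 1 ≤ weight₂ z := by
  rw [Nat.one_le_iff_ne_zero]
  intro h
  exact hz (funext fun x => funext fun y => congrFun (hammingNorm_eq_zero.1 h) (x, y))

theorem eq_zero_of_weight₂_le_one {α β M : Type*} [Fintype α] [Fintype β] [Zero M]
    [DecidableEq M] {z : α → β → M} (hz : weight₂ z ≤ 1) {a a' : α} {b b' : β} (h : z a b ≠ 0)
    (hne : (a', b') ≠ (a, b)) : z a' b' = 0 := by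
  by_contra h'
  have := Finset.card_le_one.1 hz (a', b') (by simpa using h') (a, b) (by simpa using h)
  exact hne this

theorem mul_card_le_sum {α β : Type*} [Fintype α] [Fintype β] {w : α → β → ℕ} {k : ℕ}
    (P : α × β → Prop) [DecidablePred P] (h : ∀ s t, P (s, t) → k ≤ w s t) :
    k * (Finset.univ.filter P).card ≤ ∑ s, ∑ t, w s t := by
  rw [← Fintype.sum_prod_type' , mul_comm, ← smul_eq_mul, ← Finset.sum_const]
  refine (Finset.sum_le_sum fun p hp => h p.1 p.2 (Finset.mem_filter.1 hp).2).trans ?_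
  exact Finset.sum_le_sum_of_subset (Finset.filter_subset _ _)

/-! ### Codewords with nonzero `Y0` -/

theorem numSat_le_of_opt_le {n m : ℕ} (Ψ : NANDInstance n m) {δ : ℝ} (hΨ : Ψ.opt ≤ 1 - δ)
    (x : Fin n → ZMod 2) : (Ψ.numSat x : ℝ) ≤ (1 - δ) * m := by
  rcases Nat.eq_zero_or_pos m with rfl | hm
  · simp [NANDInstance.numSat]
  · have hm' : (0 : ℝ) < m := by exact_mod_cast hm
    rw [← div_le_iff₀ hm']
    exact (le_ciSup (f := fun x => (Ψ.numSat x : ℝ) / (m : ℝ)) (Set.finite_range _).bddAbove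
      x).trans hΨ

/-- If `Y0 ≠ 0`, then a constraint on which `S` has weight `1` is satisfied by the assignment that
reads off the coordinates of `α / Y0`, where values other than `1` count as `0`. -/
theorem ConsistencyConstraints.sat_of_weight₂_le_one {n m N : ℕ} {Ψ : NANDInstance n m}
    {v : Var F n m N → F} (hv : ConsistencyConstraints Ψ v) (h0 : v .Y0 ≠ 0) {c : Fin m}
    (hc : weight₂ (fun a b => v (.S c a b)) ≤ 1) :
    (if v (.α (Ψ.k c)) = v .Y0 then (1 : ZMod 2) else 0) =
      1 + (if v (.α (Ψ.i c)) = v .Y0 then (1 : ZMod 2) else 0) *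
        (if v (.α (Ψ.j c)) = v .Y0 then (1 : ZMod 2) else 0) := by
  have hne : ∃ a b, v (.S c a b) ≠ 0 := by
    by_contra! h
    exact h0 (by simp [hv.S_sum c, h])
  obtain ⟨a, b, hab⟩ := hne
  have hsum : ∀ g : ZMod 2 → ZMod 2 → F,
      ∑ a', ∑ b', g a' b' * v (.S c a' b') = g a b * v (.S c a b) := by
    intro g
    rw [← Fintype.sum_prod_type', Finset.sum_eq_single (a, b)]
    · rintro ⟨a', b'⟩ - hne
      rw [eq_zero_of_weight₂_le_one hc hab hne, mul_zero]
    · simp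
  have hY : v .Y0 = v (.S c a b) := by
    rw [hv.S_sum c]
    simpa using hsum fun _ _ => 1
  have hread : ∀ a : ZMod 2, (if (a.val : F) * v .Y0 = v .Y0 then (1 : ZMod 2) else 0) = a := by
    have h2 : ∀ a : ZMod 2, a = 0 ∨ a = 1 := by decide
    intro a
    rcases h2 a with rfl | rfl
    · simp [h0.symm]
    · simp [ZMod.val_one]
  rw [hv.S_i c, hv.S_j c, hv.S_k c, hsum fun a _ => (a.val : F), hsum fun _ b => (b.val : F),
    hsum fun a b => ((1 + a * b : ZMod 2).val : F), ← hY, hread, hread, hread]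

theorem le_weight_of_Y0_ne_zero {n m N r : ℕ} {Ψ : NANDInstance n m} {δ : ℝ}
    (hΨ : Ψ.opt ≤ 1 - δ) {R : Fin N → Fin n → F} {v : Var F n m N → F}
    (hb : BasicConstraints R v) (hv : ConsistencyConstraints Ψ v) (h0 : v .Y0 ≠ 0) :
    (N : ℝ) ^ 2 + (1 + δ) * r * m ≤ (hammingNorm (fun c : Coord F m N r => v c.toVar) : ℝ) := by
  have hZ : N ^ 2 ≤ ∑ s, ∑ t, weight₂ (fun x y => v (.Z s t x y)) := by
    have h := mul_card_le_sum (w := fun s t => weight₂ (fun x y => v (.Z s t x y))) (k := 1)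
      (fun _ : Fin N × Fin N => True) fun s t _ => by
        refine one_le_weight₂ fun h => h0 ?_
        rw [← hb.Y0_eq s t, hv.Z_eq 0 (Nat.zero_le _) 0 (Nat.zero_le _)]
        have h' : ∀ x y, v (.Z s t x y) = 0 := fun x y => congrFun (congrFun h x) y
        simp [h']
    simpa [sq] using h
  let x : Fin n → ZMod 2 := fun i => if v (.α i) = v .Y0 then 1 else 0
  have hS : 2 * m ≤ ∑ c, weight₂ (fun a b => v (.S c a b)) + Ψ.numSat x := by
    have : 2 * m = ∑ _c : Fin m, 2 := by simp [mul_comm]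
    rw [this, NANDInstance.numSat, Finset.card_filter, ← Finset.sum_add_distrib]
    refine Finset.sum_le_sum fun c _ => ?_
    have h1 : 1 ≤ weight₂ (fun a b => v (.S c a b)) := by
      refine one_le_weight₂ fun h => h0 ?_
      have h' : ∀ a b, v (.S c a b) = 0 := fun a b => congrFun (congrFun h a) b
      simp [hv.S_sum c, h']
    by_cases hc : weight₂ (fun a b => v (.S c a b)) ≤ 1
    · have hsat : x (Ψ.k c) = 1 + x (Ψ.i c) * x (Ψ.j c) := hv.sat_of_weight₂_le_one h0 hc
      rw [if_pos hsat]
      omega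
    · omega
  have hopt := numSat_le_of_opt_le Ψ hΨ x
  have hZ' : (N : ℝ) ^ 2 ≤ ((∑ s, ∑ t, weight₂ (fun x y => v (.Z s t x y)) : ℕ) : ℝ) := by
    exact_mod_cast hZ
  have hS' : 2 * (m : ℝ) ≤ ((∑ c, weight₂ (fun a b => v (.S c a b)) : ℕ) : ℝ) + Ψ.numSat x := by
    exact_mod_cast hS
  have hS'' : (1 + δ) * m ≤ ((∑ c, weight₂ (fun a b => v (.S c a b)) : ℕ) : ℝ) := by linarith
  rw [hammingNorm_toVar, Nat.cast_add, Nat.cast_mul]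
  have := mul_le_mul_of_nonneg_left hS'' (Nat.cast_nonneg (α := ℝ) r)
  linarith

end

section

/-! ### Codewords with vanishing `Y0` -/

/-- The matrix `Y^{e,f}` of an assignment to the variables. -/
def Var.matrix {n m N : ℕ} (v : Var F n m N → F) (e f : ℕ) : Matrix (Fin N) (Fin N) F :=
  Matrix.of fun s t => v (.mat e f s t)

theorem BasicConstraints.mat_zero_left {n m N : ℕ} {R : Fin N → Fin n → F} {v : Var F n m N → F}
    (hb : BasicConstraints R v) {e : ℕ} (he : e ≤ Fintype.card F - 1) (s t : Fin N) :
    v (.mat 0 e s t) = v (.vec e t) := by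
  rw [hb.rows_eq e he s t t, hb.mat_diag 0 (Nat.zero_le _) e he, zero_add]

theorem BasicConstraints.mat_zero_right {n m N : ℕ} {R : Fin N → Fin n → F}
    {v : Var F n m N → F}
    (hb : BasicConstraints R v) {e : ℕ} (he : e ≤ Fintype.card F - 1) (s t : Fin N) :
    v (.mat e 0 s t) = v (.vec e s) := by
  rw [hb.cols_eq e he s t s, hb.mat_diag e he 0 (Nat.zero_le _), add_zero]

theorem ConsistencyConstraints.moment_Z {n m N : ℕ} {Ψ : NANDInstance n m}
    {v : Var F n m N → F} (hv : ConsistencyConstraints Ψ v) {e f : ℕ}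
    (he : e < Fintype.card F) (hf : f < Fintype.card F) (s t : Fin N) :
    moment (fun x y => v (.Z s t x y)) e f = v (.mat e f s t) :=
  (hv.Z_eq e (by omega) f (by omega) s t).symm

variable [DecidableEq F]

theorem IsPseudorandom.nonneg {n N d : ℕ} {R : Fin N → Fin n → F} {ε : ℝ}
    (hR : IsPseudorandom R d ε) : 0 ≤ ε :=
  (Finset.sum_nonneg fun _ _ => abs_nonneg _).trans (hR 0 (by simp))

/-- The two factors of `(e + 1) (f + 1) (1 - e / q) (1 - f / q)` are at least `1`, and at least
`2 (1 - 1 / q) ≥ 1 + 1 / q` unless the exponent is `0` or `q - 1`; the loss through `ε` is at most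
`(e + 1) (f + 1) * 2 ε ≤ 2 q² ε`. -/
theorem le_footprint_mul_distance {q e f ε : ℝ} (hq : 3 ≤ q) (hε : 0 ≤ ε)
    (he0 : 0 ≤ e) (he : e ≤ q - 1) (hf0 : 0 ≤ f) (hf : f ≤ q - 1)
    (h : (1 ≤ e ∧ e ≤ q - 2) ∨ (1 ≤ f ∧ f ≤ q - 2)) :
    1 + 1 / q - 2 * q ^ 2 * ε ≤
      (e + 1) * (f + 1) * ((1 - e / q - ε) * (1 - f / q - ε)) := by
  have hq0 : 0 < q := by linarith
  have key : ∀ x : ℝ, 0 ≤ x → x ≤ q - 1 → 1 ≤ (x + 1) * (1 - x / q) := by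
    intro x hx0 hx
    have : (x + 1) * (1 - x / q) - 1 = x * (q - 1 - x) / q := by field_simp; ring
    have : 0 ≤ x * (q - 1 - x) / q :=
      div_nonneg (mul_nonneg hx0 (by linarith)) hq0.le
    linarith
  have key' : ∀ x : ℝ, 1 ≤ x → x ≤ q - 2 → 1 + 1 / q ≤ (x + 1) * (1 - x / q) := by
    intro x hx0 hx
    have : (x + 1) * (1 - x / q) - (1 + 1 / q) = ((x - 1) * (q - 2 - x) + (q - 3)) / q := by
      field_simp; ring
    have : 0 ≤ ((x - 1) * (q - 2 - x) + (q - 3)) / q :=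
      div_nonneg (add_nonneg (mul_nonneg (by linarith) (by linarith)) (by linarith)) hq0.le
    linarith
  have hq1 : 0 ≤ 1 / q := by positivity
  have hmain : 1 + 1 / q ≤ ((e + 1) * (1 - e / q)) * ((f + 1) * (1 - f / q)) := by
    rcases h with ⟨h1, h2⟩ | ⟨h1, h2⟩
    · nlinarith [key' e h1 h2, key f hf0 hf]
    · nlinarith [key' f h1 h2, key e he0 he]
  have hEF : (e + 1) * (f + 1) ≤ q * q :=
    mul_le_mul (by linarith) (by linarith) (by linarith) hq0.le
  have hEF0 : 0 ≤ (e + 1) * (f + 1) := mul_nonneg (by linarith) (by linarith)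
  have hab : (1 - e / q) + (1 - f / q) ≤ 2 := by
    have := div_nonneg he0 hq0.le
    have := div_nonneg hf0 hq0.le
    linarith
  have hloss : (e + 1) * (f + 1) * (((1 - e / q) + (1 - f / q)) * ε) ≤ q * q * (2 * ε) :=
    (mul_le_mul_of_nonneg_left (mul_le_mul_of_nonneg_right hab hε) hEF0).trans
      (mul_le_mul_of_nonneg_right hEF (by linarith))
  have hsq : 0 ≤ (e + 1) * (f + 1) * (ε * ε) := by positivity
  nlinarith

section

variable {n m N : ℕ} {ε : ℝ} {R : Fin N → Fin n → F} {Ψ : NANDInstance n m} {v : Var F n m N → F}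

/-- If the vectors `Y^f` with `f < q - 1` vanish and `Y^{q-1}` does not, then `Z s t` has weight at
least `q` whenever `Y^{q-1}` is nonzero at `s` or at `t`; these pairs make up a fraction of about
`2 / q - 1 / q²`. -/
theorem le_weight_of_vec_ne_zero (hq : 3 ≤ Fintype.card F) (hN : 0 < N)
    (hR : IsPseudorandom R (Fintype.card F - 1) ε) (hε : ε * Fintype.card F ≤ 1)
    (hb : BasicConstraints R v) (hv : ConsistencyConstraints Ψ v)
    (hlow : ∀ f < Fintype.card F - 1, ∀ s, v (.vec f s) = 0)
    (htop : ∃ s, v (.vec (Fintype.card F - 1) s) ≠ 0) :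
    (1 + 1 / (Fintype.card F : ℝ) - 2 * (Fintype.card F : ℝ) ^ 2 * ε) * (N : ℝ) ^ 2 ≤
      ((∑ s, ∑ t, weight₂ (fun x y => v (.Z s t x y)) : ℕ) : ℝ) := by
  set q := Fintype.card F with hqdef
  have hε0 := hR.nonneg
  set D := Finset.univ.filter fun s => v (.vec (q - 1) s) ≠ 0 with hD
  have hright : ∀ s t, v (.vec (q - 1) t) ≠ 0 → q ≤ weight₂ (fun x y => v (.Z s t x y)) := by
    intro s t hst
    have h := mul_le_weight₂_of_moment_ne_zero (z := fun x y => v (.Z s t x y)) (e := 0)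
      (f := q - 1) (by simp) (fun f hf => by
        rw [hv.moment_Z (by omega) (by omega), hb.mat_zero_left (by omega), hlow f hf])
      (by rwa [hv.moment_Z (by omega) (by omega), hb.mat_zero_left le_rfl])
    omega
  have hleft : ∀ s t, v (.vec (q - 1) s) ≠ 0 → q ≤ weight₂ (fun x y => v (.Z s t x y)) := by
    intro s t hst
    have h := mul_le_weight₂_of_moment_ne_zero (z := fun y x => v (.Z s t x y)) (e := 0)
      (f := q - 1) (by simp) (fun f hf => by
        rw [moment_swap fun x y => v (.Z s t x y), hv.moment_Z (by omega) (by omega),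
          hb.mat_zero_right (by omega), hlow f hf])
      (by rwa [moment_swap fun x y => v (.Z s t x y), hv.moment_Z (by omega) (by omega),
          hb.mat_zero_right le_rfl])
    rw [weight₂_swap fun x y => v (.Z s t x y)] at h
    omega
  have hcount := mul_card_le_sum (w := fun s t => weight₂ (fun x y => v (.Z s t x y))) (k := q)
    (fun p : Fin N × Fin N => p ∈ (Dᶜ ×ˢ Dᶜ)ᶜ) fun s t hst => by
      by_cases hs : v (.vec (q - 1) s) ≠ 0
      · exact hleft s t hs
      · exact hright s t fun ht => by simp [hD, not_not.1 hs, ht] at hst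
  rw [Finset.filter_univ_mem] at hcount
  have hcard : (((Dᶜ ×ˢ Dᶜ)ᶜ.card : ℕ) : ℝ) = N ^ 2 - (N - D.card) ^ 2 := by
    have h1 := congrArg (Nat.cast (R := ℝ)) (Finset.card_add_card_compl (Dᶜ ×ˢ Dᶜ))
    have h2 := congrArg (Nat.cast (R := ℝ)) (Finset.card_add_card_compl D)
    rw [Finset.card_product, Fintype.card_prod, Fintype.card_fin] at h1
    rw [Fintype.card_fin] at h2
    push_cast at h1 h2
    rw [← h2] at h1 ⊢
    linarith
  obtain ⟨s₀, hs₀⟩ := htop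
  have hdist := le_hammingNorm_of_mem_polyCode hN hR le_rfl (hb.vec_mem (q - 1) le_rfl)
    (Function.ne_iff.2 ⟨s₀, hs₀⟩)
  have hdist' : (1 / q - ε) * N ≤ D.card := by
    refine le_trans (le_of_eq ?_) hdist
    have : (q : ℝ) ≠ 0 := by positivity
    rw [Nat.cast_sub (by omega)]
    field_simp
    ring
  have hDN : (D.card : ℝ) ≤ N := by
    have := Finset.card_le_univ D
    rw [Fintype.card_fin] at this
    exact_mod_cast this
  refine le_trans ?_ (Nat.cast_le.2 hcount)
  rw [Nat.cast_mul, hcard]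
  have hq' : (3 : ℝ) ≤ q := by exact_mod_cast hq
  have hN0 : (0 : ℝ) ≤ N := Nat.cast_nonneg N
  -- The count `N² - (N - |D|)²` increases with `|D| ≤ N`.
  have hmono : (N : ℝ) ^ 2 - (N - (1 / q - ε) * N) ^ 2 ≤ N ^ 2 - (N - D.card) ^ 2 := by
    have : ((N : ℝ) - D.card) ^ 2 ≤ (N - (1 / q - ε) * N) ^ 2 :=
      pow_le_pow_left₀ (by linarith) (by linarith) 2
    linarith
  refine le_trans ?_ (mul_le_mul_of_nonneg_left hmono (by linarith))
  have hnum : 1 + 1 / (q : ℝ) - 2 * q ^ 2 * ε ≤ q * (1 - (1 - (1 / q - ε)) ^ 2) := by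
    have hq0 : (q : ℝ) ≠ 0 := by positivity
    have hid : (q : ℝ) * (1 - (1 - (1 / q - ε)) ^ 2) - (1 + 1 / q - 2 * q ^ 2 * ε) =
        (q - 2) / q + ε * (2 * (q * (q - 1)) + 2 - q * ε) := by
      field_simp
      ring
    have h1 : 0 ≤ ((q : ℝ) - 2) / q := div_nonneg (by linarith) (by linarith)
    have h2 : 0 ≤ ε * (2 * (q * ((q : ℝ) - 1)) + 2 - q * ε) := by
      refine mul_nonneg hε0 ?_
      nlinarith
    linarith
  calc _ ≤ q * (1 - (1 - (1 / (q : ℝ) - ε)) ^ 2) * (N : ℝ) ^ 2 :=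
        mul_le_mul_of_nonneg_right hnum (sq_nonneg _)
    _ = _ := by ring

/-- If `Y^{q-1,q-1}` is the only nonzero matrix, then it is symmetric with zero diagonal, so that
it has two rows whose span is two-dimensional, and every `Z s t` at a nonzero entry has no zero
value. -/
theorem le_weight_of_mat_top_ne_zero (hq : 3 ≤ Fintype.card F) (hN : 0 < N)
    (hR : IsPseudorandom R (Fintype.card F - 1) ε) (hε : ε * Fintype.card F ≤ 1)
    (hb : BasicConstraints R v) (hv : ConsistencyConstraints Ψ v)
    (hlow₁ : ∀ e < Fintype.card F - 1, ∀ f < Fintype.card F, ∀ s t, v (.mat e f s t) = 0)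
    (hlow₂ : ∀ f < Fintype.card F - 1, ∀ s t, v (.mat (Fintype.card F - 1) f s t) = 0)
    (htop : ∃ s t, v (.mat (Fintype.card F - 1) (Fintype.card F - 1) s t) ≠ 0) :
    (1 + 1 / (Fintype.card F : ℝ) - 2 * (Fintype.card F : ℝ) ^ 2 * ε) * (N : ℝ) ^ 2 ≤
      ((∑ s, ∑ t, weight₂ (fun x y => v (.Z s t x y)) : ℕ) : ℝ) := by
  set q := Fintype.card F with hqdef
  have hε0 := hR.nonneg
  have hq' : (3 : ℝ) ≤ q := by exact_mod_cast hq
  set A := Var.matrix v (q - 1) (q - 1) with hA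
  have hmem : A ∈ tensorCode (polyCode R (q - 1)) (polyCode R (q - 1)) :=
    hb.mat_mem (q - 1) le_rfl (q - 1) le_rfl
  have hdiag : ∀ s, A s s = 0 := by
    intro s
    change v (.mat (q - 1) (q - 1) s s) = 0
    rw [hb.mat_diag (q - 1) le_rfl (q - 1) le_rfl, hb.vec_high _ (by omega) (by omega),
      Nat.add_sub_cancel, ← hb.mat_zero_left le_rfl s s, hlow₁ 0 (by omega) _ (by omega)]
  have hsymm : ∀ s t, A s t = A t s := hb.symm
  have hdist : ∀ u ∈ polyCode R (q - 1), u ≠ 0 → (1 / q - ε) * N ≤ (hammingNorm u : ℝ) := by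
    intro u hu hu0
    refine le_trans (le_of_eq ?_) (le_hammingNorm_of_mem_polyCode hN hR le_rfl hu hu0)
    have : (q : ℝ) ≠ 0 := by positivity
    rw [Nat.cast_sub (by omega)]
    field_simp
    ring
  obtain ⟨s₀, t₀, h₀⟩ := htop
  change A s₀ t₀ ≠ 0 at h₀
  have hsupp := card_support_pair (u := A s₀) (v := A t₀) (d := (1 / q - ε) * N)
    (hdist _ (hmem.2 t₀) (Function.ne_iff.2 ⟨s₀, by rwa [hsymm]⟩))
    (fun c => hdist _ ((polyCode R (q - 1)).add_mem (hmem.2 s₀)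
      ((polyCode R (q - 1)).smul_mem c (hmem.2 t₀)))
      (Function.ne_iff.2 ⟨t₀, by simpa [hdiag] using h₀⟩))
  set T := Finset.univ.filter fun t => A s₀ t ≠ 0 ∨ A t₀ t ≠ 0 with hT
  have hweight := card_mul_le_weight₂ (A := A) (a := (1 / q - ε) * N) T fun t ht => by
    refine hdist _ (hmem.1 t) ?_
    rcases (Finset.mem_filter.1 ht).2 with h | h
    · exact Function.ne_iff.2 ⟨s₀, h⟩
    · exact Function.ne_iff.2 ⟨t₀, h⟩
  have hcount := mul_card_le_sum (w := fun s t => weight₂ (fun x y => v (.Z s t x y)))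
    (k := q * q) (fun p : Fin N × Fin N => A p.1 p.2 ≠ 0) fun s t hst => by
      have h := mul_le_weight₂_of_moment_ne_zero (z := fun x y => v (.Z s t x y)) (e := q - 1)
        (f := q - 1)
        (fun e he f hf => by rw [hv.moment_Z (by omega) hf, hlow₁ e he f hf])
        (fun f hf => by rw [hv.moment_Z (by omega) (by omega), hlow₂ f hf])
        (by rw [hv.moment_Z (by omega) (by omega)]; exact hst)
      rwa [Nat.sub_add_cancel (by omega)] at h
  have hcount' : ((q * q : ℕ) : ℝ) * weight₂ A ≤
      ((∑ s, ∑ t, weight₂ (fun x y => v (.Z s t x y)) : ℕ) : ℝ) := by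
    exact_mod_cast hcount
  refine le_trans ?_ hcount'
  set a := (1 / (q : ℝ) - ε) * N with ha
  have hqa : q * a = (1 - ε * q) * N := by
    rw [ha]; field_simp
  have ha0 : 0 ≤ a := by
    have : 0 ≤ q * a := by
      rw [hqa]; exact mul_nonneg (by linarith) (Nat.cast_nonneg N)
    exact nonneg_of_mul_nonneg_right this (by linarith)
  have h1 : (q : ℝ) * ((q + 1) * a * a) ≤ (q * q : ℕ) * weight₂ A := by
    push_cast
    rw [mul_assoc (q : ℝ) q]
    refine mul_le_mul_of_nonneg_left ?_ (by linarith)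
    calc _ ≤ q * (T.card : ℝ) * a := mul_le_mul_of_nonneg_right hsupp ha0
      _ = q * (T.card * a) := by ring
      _ ≤ _ := mul_le_mul_of_nonneg_left hweight (by linarith)
  refine le_trans ?_ h1
  have h2 : (q : ℝ) * ((q + 1) * a * a) = (1 + 1 / q) * (1 - ε * q) ^ 2 * (N : ℝ) ^ 2 := by
    calc (q : ℝ) * ((q + 1) * a * a) = (1 + 1 / q) * (q * a) ^ 2 := by field_simp
      _ = _ := by rw [hqa]; ring
  rw [h2]
  refine mul_le_mul_of_nonneg_right ?_ (sq_nonneg _)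
  have h3 : (1 + 1 / (q : ℝ)) * (1 - ε * q) ^ 2 - (1 + 1 / q - 2 * q ^ 2 * ε) =
      2 * ε * (q * (q - 1) - 1) + (1 + 1 / q) * (ε * q) ^ 2 := by
    field_simp
    ring
  have h4 : 0 ≤ 2 * ε * ((q : ℝ) * (q - 1) - 1) :=
    mul_nonneg (by linarith) (by nlinarith)
  have h5 : 0 ≤ (1 + 1 / (q : ℝ)) * (ε * q) ^ 2 := by positivity
  linarith

/-- The weight of a codeword with `Y0 = 0` and some nonzero matrix `Y^{e,f}`: the footprint bound is
used at the lexicographically smallest such `(e, f)`. -/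
theorem le_weight_of_mat_ne_zero (hq : 3 ≤ Fintype.card F) (hN : 0 < N)
    (hR : IsPseudorandom R (Fintype.card F - 1) ε) (hε : ε * Fintype.card F ≤ 1)
    (hb : BasicConstraints R v) (hv : ConsistencyConstraints Ψ v) (h0 : v .Y0 = 0)
    (hne : ∃ e, e < Fintype.card F ∧ ∃ f, f < Fintype.card F ∧ Var.matrix v e f ≠ 0) :
    (1 + 1 / (Fintype.card F : ℝ) - 2 * (Fintype.card F : ℝ) ^ 2 * ε) * (N : ℝ) ^ 2 ≤
      ((∑ s, ∑ t, weight₂ (fun x y => v (.Z s t x y)) : ℕ) : ℝ) := by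
  classical
  obtain ⟨e, ⟨he, hex⟩, hemin⟩ : ∃ e, (e < Fintype.card F ∧
      ∃ f, f < Fintype.card F ∧ Var.matrix v e f ≠ 0) ∧ ∀ e' < e, ¬ (e' < Fintype.card F ∧
      ∃ f, f < Fintype.card F ∧ Var.matrix v e' f ≠ 0) :=
    ⟨Nat.find hne, Nat.find_spec hne, fun e' h => Nat.find_min hne h⟩
  obtain ⟨f, ⟨hf, hef⟩, hfmin⟩ : ∃ f, (f < Fintype.card F ∧ Var.matrix v e f ≠ 0) ∧
      ∀ f' < f, ¬ (f' < Fintype.card F ∧ Var.matrix v e f' ≠ 0) :=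
    ⟨Nat.find hex, Nat.find_spec hex, fun f' h => Nat.find_min hex h⟩
  have hlow₁ : ∀ e' < e, ∀ f' < Fintype.card F, ∀ s t, v (.mat e' f' s t) = 0 := by
    intro e' he' f' hf' s t
    by_contra h
    exact hemin e' he' ⟨by omega, f', hf', fun h' => h (congrFun (congrFun h' s) t)⟩
  have hlow₂ : ∀ f' < f, ∀ s t, v (.mat e f' s t) = 0 := by
    intro f' hf' s t
    by_contra h
    exact hfmin f' hf' ⟨by omega, fun h' => h (congrFun (congrFun h' s) t)⟩
  obtain ⟨s₀, t₀, h₀⟩ : ∃ s t, v (.mat e f s t) ≠ 0 := by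
    by_contra! h
    exact hef (funext fun s => funext fun t => h s t)
  have hε0 := hR.nonneg
  set q := Fintype.card F with hqdef
  have hq' : (3 : ℝ) ≤ q := by exact_mod_cast hq
  by_cases hcorner : (e = 0 ∨ e = q - 1) ∧ (f = 0 ∨ f = q - 1)
  · rcases hcorner with ⟨rfl | rfl, rfl | rfl⟩
    · exact absurd ((hb.Y0_eq s₀ t₀).trans h0) h₀
    · refine le_weight_of_vec_ne_zero hq hN hR hε hb hv (fun f hf s => ?_) ⟨t₀, ?_⟩
      · rw [← hb.mat_zero_left (by omega) s s, hlow₂ f hf]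
      · rwa [← hb.mat_zero_left le_rfl s₀]
    · rw [hb.mat_zero_right le_rfl, ← hb.mat_zero_left le_rfl s₀,
        hlow₁ 0 (by omega) _ (by omega)] at h₀
      exact absurd rfl h₀
    · exact le_weight_of_mat_top_ne_zero hq hN hR hε hb hv hlow₁ hlow₂ ⟨s₀, t₀, h₀⟩
  · have hcount := mul_card_le_sum (w := fun s t => weight₂ (fun x y => v (.Z s t x y)))
      (k := (e + 1) * (f + 1)) (fun p : Fin N × Fin N => Var.matrix v e f p.1 p.2 ≠ 0)
      fun s t hst => mul_le_weight₂_of_moment_ne_zero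
        (fun e' he' f' hf' => by rw [hv.moment_Z (by omega) hf', hlow₁ e' he' f' hf'])
        (fun f' hf' => by rw [hv.moment_Z he (by omega), hlow₂ f' hf'])
        (by rw [hv.moment_Z he hf]; exact hst)
    have hcount' : (((e + 1) * (f + 1) : ℕ) : ℝ) * weight₂ (Var.matrix v e f) ≤
        ((∑ s, ∑ t, weight₂ (fun x y => v (.Z s t x y)) : ℕ) : ℝ) := by
      exact_mod_cast hcount
    refine le_trans ?_ hcount'
    have he1 : (e : ℝ) ≤ q - 1 := by
      rw [le_sub_iff_add_le]; exact_mod_cast he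
    have hf1 : (f : ℝ) ≤ q - 1 := by
      rw [le_sub_iff_add_le]; exact_mod_cast hf
    have ha0 : 0 ≤ (1 - (e : ℝ) / q - ε) * N := by
      refine mul_nonneg ?_ (Nat.cast_nonneg N)
      have : 0 ≤ (q - e - ε * q) / (q : ℝ) := div_nonneg (by linarith) (by linarith)
      have h' : 1 - (e : ℝ) / q - ε = (q - e - ε * q) / (q : ℝ) := by field_simp
      rwa [h']
    have hdist := mul_le_weight₂_of_mem_tensorCode ha0
      (fun u hu hu0 => le_hammingNorm_of_mem_polyCode hN hR (by omega) hu hu0)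
      (fun u hu hu0 => le_hammingNorm_of_mem_polyCode hN hR (by omega) hu hu0)
      (hb.mat_mem e (by omega) f (by omega)) hef
    have hmid : ∀ k : ℕ, k < q → ¬ (k = 0 ∨ k = q - 1) → (1 : ℝ) ≤ k ∧ (k : ℝ) ≤ q - 2 := by
      intro k hk h
      constructor
      · have : 1 ≤ k := by omega
        exact_mod_cast this
      · have : k + 2 ≤ q := by omega
        rw [le_sub_iff_add_le]
        exact_mod_cast this
    have hnum := le_footprint_mul_distance hq' hε0 (Nat.cast_nonneg e) he1 (Nat.cast_nonneg f) hf1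
      (by
        rcases not_and_or.1 hcorner with h | h
        · exact Or.inl (hmid e he h)
        · exact Or.inr (hmid f hf h))
    calc _ ≤ (e + 1) * (f + 1) * ((1 - (e : ℝ) / q - ε) * (1 - f / q - ε)) * (N : ℝ) ^ 2 :=
          mul_le_mul_of_nonneg_right hnum (sq_nonneg _)
      _ = ((e + 1) * (f + 1) : ℕ) *
            (((1 - (e : ℝ) / q - ε) * N) * ((1 - f / q - ε) * N)) := by
          push_cast; ring
      _ ≤ _ := mul_le_mul_of_nonneg_left hdist (Nat.cast_nonneg _)

end

end

section

/-! ### The projection to the coordinates of the final code is injective -/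

theorem S_eq_zero {n m N : ℕ} {Ψ : NANDInstance n m} {v : Var F n m N → F}
    (hv : ConsistencyConstraints Ψ v) (h0 : v .Y0 = 0) (hα : ∀ i, v (.α i) = 0)
    (c : Fin m) (a b : ZMod 2) : v (.S c a b) = 0 := by
  have h2 : ∀ a : ZMod 2, a = 0 ∨ a = 1 := by decide
  have hval : ((1 + 1 : ZMod 2).val : F) = 0 := by
    have : (1 + 1 : ZMod 2) = 0 := by decide
    rw [this, ZMod.val_zero, Nat.cast_zero]
  have h1 := hv.S_sum c
  have hi := hv.S_i c
  have hj := hv.S_j c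
  have hk := hv.S_k c
  simp only [sum_zmod_two, h0, hα, ZMod.val_zero, ZMod.val_one, Nat.cast_zero, Nat.cast_one,
    zero_mul, one_mul, mul_zero, mul_one, add_zero, zero_add, hval] at h1 hi hj hk
  have h11 : v (.S c 1 1) = 0 := by linear_combination hk - h1
  have h10 : v (.S c 1 0) = 0 := by linear_combination -hi - h11
  have h01 : v (.S c 0 1) = 0 := by linear_combination -hj - h11
  have h00 : v (.S c 0 0) = 0 := by linear_combination -hk - h01 - h10
  rcases h2 a with rfl | rfl <;> rcases h2 b with rfl | rfl <;> assumption

variable [DecidableEq F]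

/-- The encoding `α ↦ C(α)` is injective: a nonzero linear form cannot vanish on all of `R`. -/
theorem eq_zero_of_linear_eq_zero (hq : 3 ≤ Fintype.card F) {n N : ℕ} (hN : 0 < N) {ε : ℝ}
    {R : Fin N → Fin n → F} (hR : IsPseudorandom R (Fintype.card F - 1) ε)
    (hε : ε * Fintype.card F ≤ 1) {α : Fin n → F} (h : ∀ s, ∑ i, α i * R s i = 0) : α = 0 := by
  by_contra hα
  obtain ⟨i₀, hi₀⟩ := Function.ne_iff.1 hα
  let p : MvPolynomial (Fin n) F := ∑ i, MvPolynomial.C (α i) * MvPolynomial.X i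
  have hp0 : p ≠ 0 := by
    intro hp
    have := congrArg (MvPolynomial.eval (Pi.single i₀ 1)) hp
    simp [p, Pi.single_apply] at this
    exact hi₀ this
  have hp : p.totalDegree ≤ 1 := by
    refine MvPolynomial.totalDegree_finsetSum_le fun i _ => ?_
    refine (MvPolynomial.totalDegree_mul _ _).trans ?_
    simp
  have hdist := hR.le_card_eval_ne_zero hN (by omega) hp hp0
  have hzero : ∀ s, MvPolynomial.eval (R s) p = 0 := fun s => by simp [p, h s]
  simp only [hzero, ne_eq, not_true, Finset.filter_false, Finset.card_empty] at hdist
  have hq' : (3 : ℝ) ≤ Fintype.card F := by exact_mod_cast hq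
  have hN' : (0 : ℝ) < N := by exact_mod_cast hN
  have hid : (1 - ((1 : ℕ) : ℝ) / Fintype.card F - ε) * N =
      (Fintype.card F - 1 - ε * Fintype.card F) / Fintype.card F * N := by
    field_simp
    push_cast
    ring
  have : 0 < ((Fintype.card F : ℝ) - 1 - ε * Fintype.card F) / Fintype.card F * N :=
    mul_pos (div_pos (by linarith) (by linarith)) hN'
  rw [hid] at hdist
  norm_num at hdist
  linarith

theorem exists_mat_ne_zero (hq : 3 ≤ Fintype.card F) {n m N r : ℕ} (hN : 0 < N) {ε : ℝ}
    {R : Fin N → Fin n → F} (hR : IsPseudorandom R (Fintype.card F - 1) ε)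
    (hε : ε * Fintype.card F ≤ 1) {Ψ : NANDInstance n m} {v : Var F n m N → F}
    (hb : BasicConstraints R v) (hv : ConsistencyConstraints Ψ v) (h0 : v .Y0 = 0)
    (hne : (fun c : Coord F m N r => v c.toVar) ≠ 0) :
    ∃ e, e < Fintype.card F ∧ ∃ f, f < Fintype.card F ∧ Var.matrix v e f ≠ 0 := by
  by_contra! h
  have hmat : ∀ e < Fintype.card F, ∀ f < Fintype.card F, ∀ s t, v (.mat e f s t) = 0 :=
    fun e he f hf s t => congrFun (congrFun (h e he f hf) s) t
  have hZ : ∀ s t x y, v (.Z s t x y) = 0 := fun s t x y =>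
    congrFun (congrFun (eq_zero_of_moments_eq_zero (z := fun x y => v (.Z s t x y))
      fun e he f hf => by rw [hv.moment_Z he hf, hmat e he f hf]) x) y
  have hα : (fun i => v (.α i)) = 0 := eq_zero_of_linear_eq_zero hq hN hR hε fun s => by
    rw [← hb.α_eq s, ← hb.mat_zero_left (by omega) s s, hmat 0 (by omega) 1 (by omega)]
  refine hne (funext fun c => ?_)
  rcases c with ⟨s, t, x, y⟩ | ⟨_, c, a, b⟩
  · exact hZ s t x y
  · exact S_eq_zero hv h0 (fun i => congrFun hα i) c a b

/-! ### The code is nonzero -/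

omit [DecidableEq F] in
/-- A function of one coordinate that vanishes at `0` is given by a polynomial of degree at most
`q - 1` without constant term. -/
theorem comp_coord_mem_polyCode {n N : ℕ} (R : Fin N → Fin n → F) (i : Fin n) {g : F → F}
    (hg : g 0 = 0) : (fun s => g (R s i)) ∈ polyCode R (Fintype.card F - 1) := by
  classical
  let P : Polynomial F := Lagrange.interpolate Finset.univ id g
  have hP : ∀ x, P.eval x = g x := fun x =>
    Lagrange.eval_interpolate_at_node g (Set.injOn_id _) (Finset.mem_univ x)
  have hdeg : P.natDegree ≤ Fintype.card F - 1 := by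
    have hlt : P.degree < (Finset.univ : Finset F).card :=
      Lagrange.degree_interpolate_lt g (Set.injOn_id _)
    rw [Finset.card_univ] at hlt
    have hpos : 0 < Fintype.card F := Fintype.card_pos
    by_cases hP0 : P = 0
    · simp [hP0]
    · have := (Polynomial.natDegree_lt_iff_degree_lt hP0).2 hlt
      omega
  have heval : ∀ x : Fin n → F,
      MvPolynomial.eval x (Polynomial.aeval (MvPolynomial.X i : MvPolynomial (Fin n) F) P) =
        g (x i) := by
    intro x
    rw [← hP, Polynomial.aeval_eq_sum_range, map_sum, Polynomial.eval_eq_sum_range]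
    simp [MvPolynomial.smul_eval]
  refine ⟨Polynomial.aeval (MvPolynomial.X i) P, ?_, fun _ => ?_, fun t => (heval _).symm⟩
  · rw [Polynomial.aeval_eq_sum_range]
    refine MvPolynomial.totalDegree_finsetSum_le fun k hk => ?_
    refine (MvPolynomial.totalDegree_smul_le _ _).trans ?_
    rw [MvPolynomial.totalDegree_X_pow]
    rw [Finset.mem_range] at hk
    omega
  · rw [heval]
    exact hg

omit [DecidableEq F] in
theorem sum_pow_card_sub_one : ∑ x : F, x ^ (Fintype.card F - 1) = -1 := by
  classical
  have hq : 1 < Fintype.card F := Fintype.one_lt_card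
  have h : ∀ x : F, x ^ (Fintype.card F - 1) = 1 - if x = 0 then 1 else 0 := by
    intro x
    by_cases hx : x = 0
    · rw [hx, zero_pow (by omega), if_pos rfl, sub_self]
    · rw [FiniteField.pow_card_sub_one_eq_one x hx, if_neg hx, sub_zero]
  simp [h]

/-- If some coordinate takes two distinct nonzero values on `R`, then there is a codeword all of
whose nonzero matrices `Y^{e,f}` have `e = f = q - 1`: the entry of `Y^{q-1,q-1}` indicates that the
values of this coordinate at `s` and at `t` are distinct and nonzero, and `Z s t` is constant. -/
theorem exists_mem_code_ne_zero_of_coord {n m N : ℕ} (R : Fin N → Fin n → F)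
    (Ψ : NANDInstance n m) (r : ℕ) {i : Fin n} {s₀ t₀ : Fin N} (hs : R s₀ i ≠ 0)
    (ht : R t₀ i ≠ 0) (hst : R s₀ i ≠ R t₀ i) : ∃ w ∈ code R Ψ r, w ≠ 0 := by
  set q := Fintype.card F with hq
  have hq1 : 1 < q := Fintype.one_lt_card
  let B : F → F → F := fun x y => if x ≠ 0 ∧ y ≠ 0 ∧ x ≠ y then 1 else 0
  have hB0 : ∀ y, B 0 y = 0 := fun y => by simp [B]
  have hB0' : ∀ x, B x 0 = 0 := fun x => by simp [B]
  have hBd : ∀ x, B x x = 0 := fun x => by simp [B]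
  have hBs : ∀ x y, B x y = B y x := fun x y => by
    simp only [B]
    congr 1
    simp only [eq_iff_iff]
    tauto
  let v : Var F n m N → F
    | .α _ => 0
    | .Y0 => 0
    | .vec _ _ => 0
    | .mat e f s t => if e = q - 1 ∧ f = q - 1 then B (R s i) (R t i) else 0
    | .Z s t _ _ => B (R s i) (R t i)
    | .S _ _ _ => 0
  have hmat : ∀ e f s t, v (.mat e f s t) =
      if e = q - 1 ∧ f = q - 1 then B (R s i) (R t i) else 0 := fun _ _ _ _ => rfl
  have hb : BasicConstraints R v := by
    refine ⟨fun e _ => (polyCode R e).zero_mem, fun _ _ _ _ => rfl, ?_, ?_, ?_, ?_, ?_, ?_, ?_⟩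
    · intro e _ f _
      by_cases h : e = q - 1 ∧ f = q - 1
      · obtain ⟨rfl, rfl⟩ := h
        refine ⟨fun t => ?_, fun s => ?_⟩
        · simpa [hmat] using comp_coord_mem_polyCode R i (g := fun x => B x (R t i)) (hB0 _)
        · simpa [hmat] using comp_coord_mem_polyCode R i (g := fun y => B (R s i) y) (hB0' _)
      · have : Matrix.of (fun s t => v (.mat e f s t)) = 0 := by
          funext s t
          simp [hmat, h]
        rw [this]
        exact Submodule.zero_mem _
    · intro e _ f _ s
      rw [hmat, hBd, ite_self]
    · intro e _ s s' t
      rw [hmat, hmat, if_neg (by omega), if_neg (by omega)]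
    · intro e _ s t t'
      rw [hmat, hmat, if_neg (by omega), if_neg (by omega)]
    · intro s t
      rw [hmat, hmat, hBs]
    · intro s t
      rw [hmat, if_neg (by omega)]
    · intro s
      simp [v]
  have hc : ConsistencyConstraints Ψ v := by
    refine ⟨?_, ?_, ?_, ?_, ?_⟩
    · intro c; simp [v]
    · intro c; simp [v]
    · intro c; simp [v]
    · intro c; simp [v]
    · intro e he f hf s t
      have hprod : ∑ x : F, ∑ y : F, x ^ e * y ^ f * v (.Z s t x y) =
          (∑ x : F, x ^ e) * (∑ y : F, y ^ f) * B (R s i) (R t i) := by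
        rw [Finset.sum_mul_sum, Finset.sum_mul]
        exact Finset.sum_congr rfl fun x _ => (Finset.sum_mul _ _ _).symm
      rw [hprod, hmat]
      rcases he.lt_or_eq with he | rfl
      · rw [FiniteField.sum_pow_lt_card_sub_one F e he, zero_mul, zero_mul, if_neg (by omega)]
      · rcases hf.lt_or_eq with hf | rfl
        · rw [FiniteField.sum_pow_lt_card_sub_one F f hf, mul_zero, zero_mul, if_neg (by omega)]
        · rw [sum_pow_card_sub_one, if_pos ⟨rfl, rfl⟩, neg_mul_neg, one_mul, one_mul]
  refine ⟨fun c => v c.toVar, ⟨v, ⟨hb, hc⟩, rfl⟩, Function.ne_iff.2 ⟨.inl (s₀, t₀, 0, 0), ?_⟩⟩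
  change B (R s₀ i) (R t₀ i) ≠ 0
  simp [B, hs, ht, hst]

/-- For `n = 0` the constant `Y0 = 1` is a codeword, with `Z s t` the indicator function of the
origin. -/
theorem exists_mem_code_ne_zero_of_isEmpty {m N : ℕ} (hN : 0 < N) (R : Fin N → Fin 0 → F)
    (Ψ : NANDInstance 0 m) (r : ℕ) : ∃ w ∈ code R Ψ r, w ≠ 0 := by
  have hq1 : 1 < Fintype.card F := Fintype.one_lt_card
  let v : Var F 0 m N → F
    | .α _ => 0
    | .Y0 => 1
    | .vec e _ => if e = 0 then 1 else 0
    | .mat e f _ _ => if e = 0 ∧ f = 0 then 1 else 0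
    | .Z _ _ x y => if x = 0 ∧ y = 0 then 1 else 0
    | .S _ _ _ => 0
  have hconst : ∀ e, (fun _ : Fin N => if e = 0 then (1 : F) else 0) ∈ polyCode R e := by
    intro e
    refine ⟨MvPolynomial.C (if e = 0 then 1 else 0), by
      rw [MvPolynomial.totalDegree_C]; exact Nat.zero_le _, fun he => ?_, by simp⟩
    simp [show e ≠ 0 by omega]
  have hb : BasicConstraints R v := by
    refine ⟨fun e _ => hconst e, ?_, ?_, ?_, fun _ _ _ _ _ => rfl, fun _ _ _ _ _ => rfl,
      fun _ _ => rfl, fun _ _ => rfl, ?_⟩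
    · intro e h1 h2 s
      change (if e = 0 then (1 : F) else 0) = if e - (Fintype.card F - 1) = 0 then 1 else 0
      rw [if_neg (by omega), if_neg (by omega)]
    · intro e _ f _
      refine ⟨fun t => ?_, fun s => ?_⟩
      · change (fun _ : Fin N => if e = 0 ∧ f = 0 then (1 : F) else 0) ∈ polyCode R e
        by_cases hf : f = 0
        · simpa [hf] using hconst e
        · simp only [hf, and_false, if_false]
          exact (polyCode R e).zero_mem
      · change (fun _ : Fin N => if e = 0 ∧ f = 0 then (1 : F) else 0) ∈ polyCode R f
        by_cases he : e = 0
        · simpa [he] using hconst f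
        · simp only [he, false_and, if_false]
          exact (polyCode R f).zero_mem
    · intro e _ f _ s
      change (if e = 0 ∧ f = 0 then (1 : F) else 0) = if e + f = 0 then 1 else 0
      simp only [Nat.add_eq_zero_iff]
    · intro s
      change (if 1 = 0 then (1 : F) else 0) = _
      simp
  have hc : ConsistencyConstraints Ψ v := by
    refine ⟨fun c => (Ψ.i c).elim0, fun c => (Ψ.i c).elim0, fun c => (Ψ.i c).elim0,
      fun c => (Ψ.i c).elim0, ?_⟩
    intro e _ f _ s t
    change (if e = 0 ∧ f = 0 then (1 : F) else 0) =
      ∑ x : F, ∑ y : F, x ^ e * y ^ f * if x = 0 ∧ y = 0 then 1 else 0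
    rw [Finset.sum_eq_single 0, Finset.sum_eq_single 0]
    · by_cases he : e = 0 <;> by_cases hf : f = 0 <;> simp [he, hf]
    · intro y _ hy; simp [hy]
    · simp
    · intro x _ hx; simp [hx]
    · simp
  refine ⟨fun c => v c.toVar, ⟨v, ⟨hb, hc⟩, rfl⟩,
    Function.ne_iff.2 ⟨.inl (⟨0, hN⟩, ⟨0, hN⟩, 0, 0), ?_⟩⟩
  change (if (0 : F) = 0 ∧ (0 : F) = 0 then (1 : F) else 0) ≠ 0
  simp

theorem exists_mem_code_ne_zero (hq : 3 ≤ Fintype.card F) {n m N : ℕ} (hN : 0 < N) {ε : ℝ}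
    {R : Fin N → Fin n → F} (hR : IsPseudorandom R (Fintype.card F - 1) ε)
    (hε : ε * Fintype.card F < 1) (Ψ : NANDInstance n m) (r : ℕ) :
    ∃ w ∈ code R Ψ r, w ≠ 0 := by
  rcases Nat.eq_zero_or_pos n with rfl | hn
  · exact exists_mem_code_ne_zero_of_isEmpty hN R Ψ r
  have hq' : (3 : ℝ) ≤ Fintype.card F := by exact_mod_cast hq
  have hN' : (0 : ℝ) < N := by exact_mod_cast hN
  let i : Fin n := ⟨0, hn⟩
  have hexists : ∀ p : MvPolynomial (Fin n) F, p ≠ 0 → p.totalDegree ≤ 2 →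
      ∃ s, MvPolynomial.eval (R s) p ≠ 0 := by
    intro p hp0 hp
    by_contra! h
    have hdist := hR.le_card_eval_ne_zero hN (by omega) hp hp0
    simp only [h, ne_eq, not_true, Finset.filter_false, Finset.card_empty] at hdist
    have hid : (1 - ((2 : ℕ) : ℝ) / Fintype.card F - ε) * N =
        (Fintype.card F - 2 - ε * Fintype.card F) / Fintype.card F * N := by
      field_simp
      push_cast
      ring
    have : 0 < ((Fintype.card F : ℝ) - 2 - ε * Fintype.card F) / Fintype.card F * N :=
      mul_pos (div_pos (by linarith) (by linarith)) hN'
    rw [hid] at hdist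
    norm_num at hdist
    linarith
  obtain ⟨s, hs⟩ := hexists (MvPolynomial.X i) (MvPolynomial.X_ne_zero i) (by simp)
  rw [MvPolynomial.eval_X] at hs
  have hlin0 : (MvPolynomial.X i - MvPolynomial.C (R s i) : MvPolynomial (Fin n) F) ≠ 0 := by
    intro h
    have := congrArg (MvPolynomial.eval (fun _ => R s i + 1)) h
    simp at this
  have hlin : (MvPolynomial.X i - MvPolynomial.C (R s i) : MvPolynomial (Fin n) F).totalDegree
      ≤ 1 := by
    refine (MvPolynomial.totalDegree_sub _ _).trans ?_
    simp
  obtain ⟨t, ht⟩ := hexists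
    (MvPolynomial.X i * (MvPolynomial.X i - MvPolynomial.C (R s i)))
    (mul_ne_zero (MvPolynomial.X_ne_zero i) hlin0)
    ((MvPolynomial.totalDegree_mul _ _).trans (by rw [MvPolynomial.totalDegree_X]; omega))
  rw [map_mul, map_sub, MvPolynomial.eval_X, MvPolynomial.eval_C] at ht
  exact exists_mem_code_ne_zero_of_coord R Ψ r hs (left_ne_zero_of_mul ht)
    (sub_ne_zero.1 (right_ne_zero_of_mul ht)).symm

end

end MinDistReduction

theorem mainTheorem3 {F : Type*} [Field F] [Fintype F] [DecidableEq F]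
    (hq : 3 ≤ Fintype.card F)
    {n m N : ℕ} (hN : 0 < N) (ε : ℝ) (R : Fin N → Fin n → F)
    (hR : MinDistReduction.IsPseudorandom R (Fintype.card F - 1) ε)
    (Ψ : MinDistReduction.NANDInstance n m) (δ : ℝ) (hΨ : Ψ.opt ≤ 1 - δ)
    (r : ℕ) (hr : 1 ≤ r) :
    min ((N : ℝ) ^ 2 + (1 + δ) * (r : ℝ) * (m : ℝ))
        ((1 + 1 / (Fintype.card F : ℝ) - 2 * (Fintype.card F : ℝ) ^ 2 * ε) * (N : ℝ) ^ 2) ≤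
      (MinDistReduction.codeDist (MinDistReduction.code R Ψ r) : ℝ) := by
  have hq' : (3 : ℝ) ≤ Fintype.card F := by exact_mod_cast hq
  rcases le_or_gt 1 (ε * Fintype.card F) with hε | hε
  · -- For `ε ≥ 1 / q` the second term of the minimum is not positive.
    refine (min_le_right _ _).trans (le_trans ?_ (Nat.cast_nonneg _))
    refine mul_nonpos_of_nonpos_of_nonneg ?_ (sq_nonneg _)
    have h1 : 1 / (Fintype.card F : ℝ) ≤ 1 := by
      rw [div_le_one (by linarith)]
      linarith
    have h2 : 1 * (Fintype.card F : ℝ) ≤ ε * Fintype.card F * Fintype.card F :=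
      mul_le_mul_of_nonneg_right hε (by linarith)
    nlinarith
  obtain ⟨w₀, hw₀, hw₀'⟩ := MinDistReduction.exists_mem_code_ne_zero hq hN hR hε Ψ r
  obtain ⟨w, ⟨v, ⟨hb, hv⟩, rfl⟩, hne, hw⟩ := Nat.sInf_mem
    (s := {k : ℕ | ∃ w ∈ MinDistReduction.code R Ψ r, w ≠ 0 ∧ hammingNorm w = k})
    ⟨_, w₀, hw₀, hw₀', rfl⟩
  rw [MinDistReduction.codeDist, ← hw]
  change _ ≤ ((hammingNorm fun c : MinDistReduction.Coord F m N r => v c.toVar : ℕ) : ℝ)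
  by_cases h0 : v .Y0 = 0
  · refine (min_le_right _ _).trans ?_
    refine (MinDistReduction.le_weight_of_mat_ne_zero hq hN hR hε.le hb hv h0
      (MinDistReduction.exists_mat_ne_zero hq hN hR hε.le hb hv h0 hne)).trans ?_
    rw [MinDistReduction.hammingNorm_toVar]
    exact Nat.cast_le.2 (Nat.le_add_right _ _)
  · exact (min_le_left _ _).trans (MinDistReduction.le_weight_of_Y0_ne_zero hΨ hb hv h0)
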